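/- Let $(M^n,g)$, $n\ge 2$, be a smooth Riemannian manifold (without boundary) with Levi-Civita connection $\nabla$, Ricci tensor $\mathrm{Ric}$ and scalar curvature $R$, and let $(M^n,g,X,\rho)$ be an almost Yamabe soliton, i.e. $X$ is a smooth vector field and $\rho$ a smooth function on $M$ with $$\tfrac12\,\mathcal L_X g=(R-\rho)\,g .$$ Put $\psi=R-\rho$, and assume that $X$ is closed, i.e. $\nabla_YX=\psi\,Y$ for every vector field $Y$. Then either (i) $X$ is a Killing vector field, i.e. $\mathcal L_Xg=0$ on $M$, or (ii) at every point where $X\neq 0$, $$\Big[Dd\psi+\frac{R\psi}{n-1}\,g-\psi\,\mathrm{Ric}\Big]\Big(\frac{X}{|X|},\frac{X}{|X|}\Big)=\Delta\psi+\frac{R\psi}{n-1},$$ where $Dd\psi$ is the Hessian of $\psi$, i.e. $Dd\psi(Y,Z)=g(\nabla_Y\nabla\psi,Z)$, and $\Delta\psi$ is its trace with respect to $g$. -/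

import Mathlib

open Bundle Manifold VectorField FiberBundle
open scoped ContDiff

namespace Riem

noncomputable section

variable {E : Type*} [NormedAddCommGroup E] [NormedSpace ℝ E] [FiniteDimensional ℝ E]
  {H : Type*} [TopologicalSpace H] {I : ModelWithCorners ℝ E H}
  {M : Type*} [TopologicalSpace M] [ChartedSpace H M] [IsManifold I ∞ M]
  [RiemannianBundle (fun x : M => TangentSpace I x)]
  [IsContMDiffRiemannianBundle I ∞ E (fun x : M => TangentSpace I x)]

instance finiteDimensionalTangentSpace (p : M) : FiniteDimensional ℝ (TangentSpace I p) :=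
  VectorBundle.finiteDimensional ℝ E (fun x : M => TangentSpace I x) p

instance completeTangentSpace (p : M) : CompleteSpace (TangentSpace I p) :=
  FiniteDimensional.complete ℝ (TangentSpace I p)

/-- The musical isomorphism `♯ : T*_p M → T_p M`, defined by `⟨φ♯, w⟩ = φ w`. -/
def sharp (p : M) : (TangentSpace I p →L[ℝ] ℝ) →L[ℝ] TangentSpace I p :=
  LinearMap.toContinuousLinearMap
    { toFun := fun φ => (InnerProductSpace.toDual ℝ (TangentSpace I p)).symm φ
      map_add' := fun φ φ' => by simp
      map_smul' := fun c φ => by simp }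

theorem inner_sharp (p : M) (φ : TangentSpace I p →L[ℝ] ℝ) (w : TangentSpace I p) :
    inner ℝ (sharp p φ) w = φ w :=
  InnerProductSpace.toDual_symm_apply

theorem mdifferentiableAt_inner {X Y : Π x : M, TangentSpace I x} {p : M}
    (hX : MDiffAt (T% X) p) (hY : MDiffAt (T% Y) p) :
    MDiffAt (fun q => inner ℝ (X q) (Y q)) p :=
  MDifferentiableAt.inner_bundle (E := fun x : M => TangentSpace I x) hX hY

/-! ### The Levi-Civita connection -/

/-- The right-hand side of the Koszul formula: for differentiable vector fields this is
`2⟨∇_Y X, Z⟩` at `p`. -/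
def koszul (X Y Z : Π x : M, TangentSpace I x) (p : M) : ℝ :=
  d% (fun q => inner ℝ (X q) (Z q)) p (Y p) + d% (fun q => inner ℝ (Y q) (Z q)) p (X p)
    - d% (fun q => inner ℝ (Y q) (X q)) p (Z p)
    + inner ℝ (mlieBracket I Y X p) (Z p) - inner ℝ (mlieBracket I Y Z p) (X p)
    - inner ℝ (mlieBracket I X Z p) (Y p)

theorem koszul_tensorial_Y {X Z : Π x : M, TangentSpace I x} {p : M}
    (hX : MDiffAt (T% X) p) (hZ : MDiffAt (T% Z) p) :
    TensorialAt I E (fun Y => koszul X Y Z p) p where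
  smul {f Y} hf hY := by
    have h1 : (fun q => inner ℝ ((f • Y) q) (Z q)) = f * fun q => inner ℝ (Y q) (Z q) := by
      ext q; simp [inner_smul_left]
    have h2 : (fun q => inner ℝ ((f • Y) q) (X q)) = f * fun q => inner ℝ (Y q) (X q) := by
      ext q; simp [inner_smul_left]
    simp only [koszul, h1, h2, mvfderiv_mul hf (mdifferentiableAt_inner hY hZ),
      mvfderiv_mul hf (mdifferentiableAt_inner hY hX), mlieBracket_smul_left hf hY]
    simp [inner_add_left, inner_smul_left, inner_smul_right]
    ring
  add {Y Y'} hY hY' := by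
    have h1 : (fun q => inner ℝ ((Y + Y') q) (Z q)) =
        (fun q => inner ℝ (Y q) (Z q)) + fun q => inner ℝ (Y' q) (Z q) := by
      ext q; simp [inner_add_left]
    have h2 : (fun q => inner ℝ ((Y + Y') q) (X q)) =
        (fun q => inner ℝ (Y q) (X q)) + fun q => inner ℝ (Y' q) (X q) := by
      ext q; simp [inner_add_left]
    simp only [koszul, h1, h2, mvfderiv_add (mdifferentiableAt_inner hY hZ) (mdifferentiableAt_inner hY' hZ),
      mvfderiv_add (mdifferentiableAt_inner hY hX) (mdifferentiableAt_inner hY' hX), mlieBracket_add_left hY hY']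
    simp [inner_add_left, inner_add_right]
    ring

theorem koszul_tensorial_Z {X Y : Π x : M, TangentSpace I x} {p : M}
    (hX : MDiffAt (T% X) p) (hY : MDiffAt (T% Y) p) :
    TensorialAt I E (fun Z => koszul X Y Z p) p where
  smul {f Z} hf hZ := by
    have h1 : (fun q => inner ℝ (Y q) ((f • Z) q)) = f * fun q => inner ℝ (Y q) (Z q) := by
      ext q; simp [inner_smul_right]
    have h2 : (fun q => inner ℝ (X q) ((f • Z) q)) = f * fun q => inner ℝ (X q) (Z q) := by
      ext q; simp [inner_smul_right]
    simp only [koszul, h1, h2, mvfderiv_mul hf (mdifferentiableAt_inner hY hZ),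
      mvfderiv_mul hf (mdifferentiableAt_inner hX hZ), mlieBracket_smul_right hf hZ]
    simp [inner_add_left, inner_smul_left, inner_smul_right]
    rw [real_inner_comm (Z p) (X p), real_inner_comm (Z p) (Y p)]
    ring
  add {Z Z'} hZ hZ' := by
    have h1 : (fun q => inner ℝ (Y q) ((Z + Z') q)) =
        (fun q => inner ℝ (Y q) (Z q)) + fun q => inner ℝ (Y q) (Z' q) := by
      ext q; simp [inner_add_right]
    have h2 : (fun q => inner ℝ (X q) ((Z + Z') q)) =
        (fun q => inner ℝ (X q) (Z q)) + fun q => inner ℝ (X q) (Z' q) := by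
      ext q; simp [inner_add_right]
    simp only [koszul, h1, h2, mvfderiv_add (mdifferentiableAt_inner hY hZ) (mdifferentiableAt_inner hY hZ'),
      mvfderiv_add (mdifferentiableAt_inner hX hZ) (mdifferentiableAt_inner hX hZ'), mlieBracket_add_right hZ hZ']
    simp [inner_add_left, inner_add_right]
    ring

open Classical in
/-- `nabla X p v = ∇_v X`, the vector determined by the Koszul formula (and the junk value `0`
if `X` is not differentiable at `p`). -/
def nabla (X : Π x : M, TangentSpace I x) (p : M) : TangentSpace I p →L[ℝ] TangentSpace I p :=
  if hX : MDiffAt (T% X) p then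
    (1 / 2 : ℝ) • sharp p ∘L TensorialAt.mkHom₂ (fun Y Z => koszul X Y Z p) p
      (fun _ hZ => koszul_tensorial_Y hX hZ) (fun _ hY => koszul_tensorial_Z hX hY)
  else 0

theorem two_inner_nabla {X Y Z : Π x : M, TangentSpace I x} {p : M}
    (hX : MDiffAt (T% X) p) (hY : MDiffAt (T% Y) p) (hZ : MDiffAt (T% Z) p) :
    2 * inner ℝ (nabla X p (Y p)) (Z p) = koszul X Y Z p := by
  have := TensorialAt.mkHom₂_apply (Φ := fun Y Z => koszul X Y Z p)
    (fun _ hZ => koszul_tensorial_Y hX hZ) (fun _ hY => koszul_tensorial_Z hX hY) hY hZ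
  simp only [nabla, dif_pos hX, smul_apply,
    ContinuousLinearMap.comp_apply, inner_smul_left, inner_sharp, this]
  simp

theorem exists_extension {p : M} (v : TangentSpace I p) :
    ∃ V : Π x : M, TangentSpace I x, MDiffAt (T% V) p ∧ V p = v :=
  ⟨extend E v, mdifferentiableAt_extend I E v, by simp⟩

theorem nabla_add {X X' : Π x : M, TangentSpace I x} {p : M}
    (hX : MDiffAt (T% X) p) (hX' : MDiffAt (T% X') p) :
    nabla (X + X') p = nabla X p + nabla X' p := by
  ext v
  refine ext_inner_right ℝ fun w => ?_
  obtain ⟨Y, hv, rfl⟩ := exists_extension v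
  obtain ⟨Z, hw, rfl⟩ := exists_extension w
  have h1 : (fun q => inner ℝ ((X + X') q) (Z q)) =
      (fun q => inner ℝ (X q) (Z q)) + fun q => inner ℝ (X' q) (Z q) := by
    ext q; simp [inner_add_left]
  have h2 : (fun q => inner ℝ (Y q) ((X + X') q)) =
      (fun q => inner ℝ (Y q) (X q)) + fun q => inner ℝ (Y q) (X' q) := by
    ext q; simp [inner_add_right]
  have e0 := two_inner_nabla (mdifferentiableAt_add_section hX hX') hv hw
  have e1 := two_inner_nabla hX hv hw
  have e2 := two_inner_nabla hX' hv hw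
  simp only [koszul, h1, h2, mvfderiv_add (mdifferentiableAt_inner hX hw)
    (mdifferentiableAt_inner hX' hw), mvfderiv_add (mdifferentiableAt_inner hv hX)
    (mdifferentiableAt_inner hv hX'), mlieBracket_add_left hX hX',
    mlieBracket_add_right hX hX'] at e0 e1 e2
  simp only [Pi.add_apply, inner_add_left, inner_add_right, add_apply, map_add] at e0 ⊢
  linarith

theorem nabla_smul {X : Π x : M, TangentSpace I x} {f : M → ℝ} {p : M}
    (hX : MDiffAt (T% X) p) (hf : MDiffAt f p) :
    nabla (f • X) p = f p • nabla X p + (d% f p).smulRight (X p) := by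
  ext v
  refine ext_inner_right ℝ fun w => ?_
  obtain ⟨Y, hv, rfl⟩ := exists_extension v
  obtain ⟨Z, hw, rfl⟩ := exists_extension w
  have h1 : (fun q => inner ℝ ((f • X) q) (Z q)) = f * fun q => inner ℝ (X q) (Z q) := by
    ext q; simp [inner_smul_left]
  have h2 : (fun q => inner ℝ (Y q) ((f • X) q)) = f * fun q => inner ℝ (Y q) (X q) := by
    ext q; simp [inner_smul_right]
  have e0 := two_inner_nabla (hf.smul_section hX) hv hw
  have e1 := two_inner_nabla hX hv hw
  simp only [koszul, h1, h2, mvfderiv_mul hf (mdifferentiableAt_inner hX hw),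
    mvfderiv_mul hf (mdifferentiableAt_inner hv hX), mlieBracket_smul_left hf hX,
    mlieBracket_smul_right hf hX] at e0 e1
  simp [inner_add_left, inner_smul_left, inner_smul_right] at e0 ⊢
  rw [real_inner_comm (Y p) (X p)] at e0
  linear_combination (1 / 2) * e0 - (f p / 2) * e1

/-- The Levi-Civita connection of the Riemannian metric. -/
def leviCivita : CovariantDerivative I E (fun x : M => TangentSpace I x) where
  toFun := nabla
  isCovariantDerivativeOnUniv :=
    { add := fun hX hX' _ => nabla_add hX hX'
      leibniz := fun hX hf _ => nabla_smul hX hf }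

/-- The Levi-Civita connection is torsion free. -/
theorem leviCivita_torsion {X Y : Π x : M, TangentSpace I x} {p : M}
    (hX : MDiffAt (T% X) p) (hY : MDiffAt (T% Y) p) :
    leviCivita Y p (X p) - leviCivita X p (Y p) = mlieBracket I X Y p := by
  refine ext_inner_right ℝ fun w => ?_
  obtain ⟨Z, hw, rfl⟩ := exists_extension w
  have e1 := two_inner_nabla hX hY hw
  have e2 := two_inner_nabla hY hX hw
  have c : (fun q => inner ℝ (Y q) (X q)) = fun q => inner ℝ (X q) (Y q) := by
    ext q; exact real_inner_comm _ _
  have s : mlieBracket I Y X p = - mlieBracket I X Y p := mlieBracket_swap_apply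
  simp only [koszul, c, s, inner_neg_left] at e1 e2
  simp only [leviCivita, inner_sub_left]
  linarith

/-- The Levi-Civita connection is compatible with the metric. -/
theorem leviCivita_metric {X Y Z : Π x : M, TangentSpace I x} {p : M}
    (hX : MDiffAt (T% X) p) (hY : MDiffAt (T% Y) p) (hZ : MDiffAt (T% Z) p) :
    d% (fun q => inner ℝ (Y q) (Z q)) p (X p) =
      inner ℝ (leviCivita Y p (X p)) (Z p) + inner ℝ (Y p) (leviCivita Z p (X p)) := by
  have e1 := two_inner_nabla hY hX hZ
  have e2 := two_inner_nabla hZ hX hY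
  have c : (fun q => inner ℝ (Z q) (Y q)) = fun q => inner ℝ (Y q) (Z q) := by
    ext q; exact real_inner_comm _ _
  have s : mlieBracket I Z Y p = - mlieBracket I Y Z p := mlieBracket_swap_apply
  simp only [koszul, c, s, inner_neg_left] at e1 e2
  simp only [leviCivita]
  rw [real_inner_comm _ (Y p)]
  linarith

/-! ### Curvature -/

/-- `Rm(U, V)W = ∇_U ∇_V W - ∇_V ∇_U W - ∇_[U,V] W` at `p`, for vector fields. -/
def curvatureField (U V W : Π x : M, TangentSpace I x) (p : M) : TangentSpace I p :=
  leviCivita (fun q => leviCivita W q (V q)) p (U p)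
    - leviCivita (fun q => leviCivita W q (U q)) p (V p)
    - leviCivita W p (mlieBracket I U V p)

/-- The Riemann curvature `Rm(u, v)w` of tangent vectors at `p`: the value of `curvatureField` on
vector fields that are smooth near `p` and extend `u`, `v`, `w`. -/
def curvature (p : M) (u v w : TangentSpace I p) : TangentSpace I p :=
  curvatureField (I := I) (extend E u) (extend E v) (extend E w) p

/-- The Ricci curvature `Ric(v, w) = ∑ᵢ ⟨Rm(eᵢ, v)w, eᵢ⟩`, for `(eᵢ)` an orthonormal basis
of `T_p M`. -/
def ricci (p : M) (v w : TangentSpace I p) : ℝ :=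
  ∑ i, inner ℝ (curvature p (stdOrthonormalBasis ℝ (TangentSpace I p) i) v w)
    (stdOrthonormalBasis ℝ (TangentSpace I p) i)

variable (I) in
/-- The scalar curvature, the metric trace of the Ricci curvature. -/
def scalarCurvature (p : M) : ℝ :=
  ∑ i, ricci p (stdOrthonormalBasis ℝ (TangentSpace I p) i)
    (stdOrthonormalBasis ℝ (TangentSpace I p) i)

/-! ### Gradient, Hessian, Laplacian -/

variable (I) in
/-- The gradient: `⟨∇f, w⟩ = df(w)`. -/
def grad (f : M → ℝ) (p : M) : TangentSpace I p := sharp p (d% f p)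

/-- The Hessian `Ddf(v, w) = ⟨∇_v ∇f, w⟩`. -/
def hessian (f : M → ℝ) (p : M) (v w : TangentSpace I p) : ℝ :=
  inner ℝ (leviCivita (grad I f) p v) w

variable (I) in
/-- The Laplacian, the metric trace of the Hessian. -/
def laplacian (f : M → ℝ) (p : M) : ℝ :=
  ∑ i, hessian f p (stdOrthonormalBasis ℝ (TangentSpace I p) i)
    (stdOrthonormalBasis ℝ (TangentSpace I p) i)

/-! ### Almost Yamabe solitons -/

/-- The Lie derivative of the metric,
`(L_X g)(Y, Z) = X(g(Y, Z)) - g([X, Y], Z) - g(Y, [X, Z])` at `p`, for vector fields `Y`, `Z`. -/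
def lieMetricField (X Y Z : Π x : M, TangentSpace I x) (p : M) : ℝ :=
  d% (fun q => inner ℝ (Y q) (Z q)) p (X p) - inner ℝ (mlieBracket I X Y p) (Z p)
    - inner ℝ (Y p) (mlieBracket I X Z p)

/-- The Lie derivative `(L_X g)(v, w)` of the metric on tangent vectors at `p`: the value of
`lieMetricField` on vector fields that are smooth near `p` and extend `v`, `w`. -/
def lieMetric (X : Π x : M, TangentSpace I x) (p : M) (v w : TangentSpace I p) : ℝ :=
  lieMetricField X (extend E v) (extend E w) p

/-- `X` is a Killing vector field: `L_X g = 0`. -/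
def IsKilling (X : Π x : M, TangentSpace I x) : Prop :=
  ∀ (p : M) (v w : TangentSpace I p), lieMetric X p v w = 0

variable (I) in
/-- The conformal factor `ψ = R - ρ`. -/
def conformalFactor (ρ : M → ℝ) (p : M) : ℝ := scalarCurvature I p - ρ p

/-- `(M, g, X, ρ)` is an almost Yamabe soliton: `X` and `ρ` are smooth and
`(1/2) L_X g = (R - ρ) g`. -/
structure IsAlmostYamabeSoliton (X : Π x : M, TangentSpace I x) (ρ : M → ℝ) : Prop where
  smooth_field : CMDiff ∞ (T% X)
  smooth_fun : CMDiff ∞ ρ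
  lie_eq : ∀ (p : M) (v w : TangentSpace I p),
    (1 / 2) * lieMetric X p v w = conformalFactor I ρ p * inner ℝ v w

/-- The vector field `X` of an almost Yamabe soliton is closed: `∇_Y X = ψ Y` for all `Y`,
where `ψ = R - ρ`. -/
def IsClosedField (X : Π x : M, TangentSpace I x) (ρ : M → ℝ) : Prop :=
  ∀ (p : M) (v : TangentSpace I p), leviCivita X p v = conformalFactor I ρ p • v

end

end Riem

/-!
For a closed conformal field, `∇_v X = ψ v`, the curvature acts on `X` by
`Rm(u, v)X = dψ(u) v - dψ(v) u`. Since `Rm(u, X)` is skew-adjoint, pairing `Rm(u, X)X` with `X`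
gives `∇ψ = φ X` with `φ = dψ(X) / |X|²` wherever `X ≠ 0`. Differentiating once more,
`Ddψ = φ ψ g + dφ ⊗ ⟨X, ·⟩`, so that `Δψ = n φ ψ + dφ(X)`, while tracing the curvature yields
`Ric(·, X) = (1 - n) dψ`. Evaluated on `e = X / |X|`, these give
`Ddψ(e, e) = φ ψ + dφ(X)` and `Ric(e, e) = (1 - n) φ`, and the dimension cancels.
-/

namespace Riem

open scoped Topology

open Matrix in
theorem basis_repr_eq_det_gram_div {𝕜 V ι : Type*} [RCLike 𝕜] [NormedAddCommGroup V]
    [InnerProductSpace 𝕜 V] [Fintype ι] [DecidableEq ι] (b : Module.Basis ι 𝕜 V) (x : V) (i : ι) :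
    b.repr x i = ((gram 𝕜 b).updateCol i fun j => inner 𝕜 (b j) x).det / (gram 𝕜 b).det := by
  have hdet : (gram 𝕜 b).det ≠ 0 := det_gram_ne_zero_iff_linearIndependent.2 b.linearIndependent
  have hinner : (fun j => inner 𝕜 (b j) x) = gram 𝕜 b *ᵥ b.repr x := by
    ext j
    conv_lhs => rw [← b.sum_repr x]
    simp only [inner_sum, inner_smul_right, mulVec, dotProduct, gram_apply, mul_comm]
  rw [eq_div_iff hdet, ← cramer_apply, hinner, cramer_eq_adjugate_mulVec, mulVec_mulVec,
    adjugate_mul, smul_mulVec, one_mulVec, Pi.smul_apply, smul_eq_mul, mul_comm]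

section OrthonormalBasis

variable {V ι : Type*} [NormedAddCommGroup V] [InnerProductSpace ℝ V] [Fintype ι]

theorem sum_apply_mul_inner (b : OrthonormalBasis ι ℝ V) (A : V →L[ℝ] ℝ) (x : V) :
    ∑ i, A (b i) * inner ℝ x (b i) = A x := by
  conv_rhs => rw [← b.sum_repr' x, map_sum]
  simp only [map_smul, smul_eq_mul, real_inner_comm, mul_comm]

theorem sum_inner_self (b : OrthonormalBasis ι ℝ V) :
    ∑ i, inner ℝ (b i) (b i) = (Module.finrank ℝ V : ℝ) := by
  simp only [b.inner_eq_one, Finset.sum_const, Finset.card_univ, nsmul_one,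
    Module.finrank_eq_card_basis b.toBasis]

end OrthonormalBasis

section Bundles

variable {E : Type*} [NormedAddCommGroup E] [NormedSpace ℝ E]
  {H : Type*} [TopologicalSpace H] {I : ModelWithCorners ℝ E H}
  {M : Type*} [TopologicalSpace M] [ChartedSpace H M]

theorem mdifferentiableAt_pi_space {ι : Type*} [Fintype ι] {F : ι → Type*}
    [∀ i, NormedAddCommGroup (F i)] [∀ i, NormedSpace ℝ (F i)] {f : M → Π i, F i} {p : M} :
    MDifferentiableAt I 𝓘(ℝ, Π i, F i) f p ↔
      ∀ i, MDifferentiableAt I 𝓘(ℝ, F i) (fun q => f q i) p := by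
  simp only [mdifferentiableAt_iff, continuousAt_pi, forall_and]
  exact and_congr_right fun _ => differentiableWithinAt_pi

theorem mdifferentiableAt_det {ι : Type*} [Fintype ι] [DecidableEq ι] {A : M → Matrix ι ι ℝ}
    {p : M} (hA : ∀ i j, MDiffAt (fun q => A q i j) p) : MDiffAt (fun q => (A q).det) p := by
  have hdet : Differentiable ℝ fun B : ι → ι → ℝ => (Matrix.of B).det := by
    simp only [Matrix.det_apply', Matrix.of_apply]
    fun_prop
  have hA' : MDifferentiableAt I 𝓘(ℝ, ι → ι → ℝ) (fun q i j => A q i j) p :=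
    mdifferentiableAt_pi_space.2 fun i => mdifferentiableAt_pi_space.2 (hA i)
  exact hdet.differentiableAt.comp_mdifferentiableAt hA'

variable {F : Type*} [NormedAddCommGroup F] [NormedSpace ℝ F] [FiniteDimensional ℝ F]
  {V : M → Type*} [TopologicalSpace (TotalSpace F V)] [∀ x, NormedAddCommGroup (V x)]
  [∀ x, InnerProductSpace ℝ (V x)] [FiberBundle F V] [VectorBundle ℝ F V]
  {n : ℕ∞ω} [ContMDiffVectorBundle n F V I] [IsContMDiffRiemannianBundle I 1 F V]

theorem mdifferentiableAt_of_inner (hn : 1 ≤ n) {s : Π x : M, V x} {p : M}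
    (hs : ∀ Z : Π x : M, V x, CMDiffAt n (T% Z) p → MDiffAt (fun q => inner ℝ (Z q) (s q)) p) :
    MDiffAt (T% s) p := by
  classical
  have : ContMDiffVectorBundle 1 F V I := .of_le hn
  let t := trivializationAt F V p
  let b := Module.finBasis ℝ F
  let Z := t.localFrame b
  have hp : p ∈ t.baseSet := FiberBundle.mem_baseSet_trivializationAt' p
  have hZ (i) : CMDiffAt n (T% (Z i)) p := contMDiffAt_localFrame_of_mem n t b i hp
  let gram (q : M) := Matrix.gram ℝ fun i => Z i q
  have hgram (i j) : MDiffAt (fun q => gram q i j) p :=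
    MDifferentiableAt.inner_bundle ((hZ i).mdifferentiableAt (by positivity))
      ((hZ j).mdifferentiableAt (by positivity))
  have hbasis {q} (hq : q ∈ t.baseSet) : (fun i => Z i q) = t.basisAt b hq :=
    funext fun i => t.localFrame_apply_of_mem_baseSet b hq
  have hdet : (gram p).det ≠ 0 := Matrix.det_gram_ne_zero_iff_linearIndependent.2 <| by
    rw [hbasis hp]; exact (t.basisAt b hp).linearIndependent
  refine (mdifferentiableAt_iff_localFrameCoeff b hp).2 fun i => ?_
  have hnum : MDiffAt (fun q => ((gram q).updateCol i fun j => inner ℝ (Z j q) (s q)).det) p := by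
    refine mdifferentiableAt_det fun j k => ?_
    obtain rfl | hk := eq_or_ne k i
    · simpa only [Matrix.updateCol_self] using hs (Z j) (hZ j)
    · simpa only [Matrix.updateCol_ne hk] using hgram j k
  refine (hnum.mul ((mdifferentiableAt_det hgram).inv hdet)).congr_of_eventuallyEq ?_
  filter_upwards [t.open_baseSet.mem_nhds hp] with q hq
  have h := basis_repr_eq_det_gram_div (t.basisAt b hq) (s q) i
  rw [← hbasis hq, div_eq_mul_inv] at h
  exact (t.localFrameCoeff_apply_of_mem_baseSet b hq s i).trans h

end Bundles

/-! ### Directional derivatives and Lie brackets -/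

section Brackets

variable {E : Type*} [NormedAddCommGroup E] [NormedSpace ℝ E]
  {H : Type*} [TopologicalSpace H] {I : ModelWithCorners ℝ E H}
  {M : Type*} [TopologicalSpace M] [ChartedSpace H M]

theorem mvfderiv_congr {F : Type*} [NormedAddCommGroup F] [NormedSpace ℝ F] {f g : M → F} {p : M}
    (h : f =ᶠ[𝓝 p] g) : d% f p = d% g p := by
  ext v
  exact congrArg (fun A : E →L[ℝ] F => A v) h.mfderiv_eq

theorem eventually_mdifferentiableAt {E' H' M' : Type*} [NormedAddCommGroup E'] [NormedSpace ℝ E']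
    [TopologicalSpace H'] {J : ModelWithCorners ℝ E' H'} [TopologicalSpace M'] [ChartedSpace H' M']
    [IsManifold I 1 M] [IsManifold J 1 M'] {f : M → M'} {p : M} (hf : CMDiffAt 1 f p) :
    ∀ᶠ q in 𝓝 p, MDiffAt f q :=
  ((contMDiffAt_iff_contMDiffAt_nhds (by simp)).1 hf).mono
    fun _ hq => hq.mdifferentiableAt one_ne_zero

theorem contMDiffAt_mvfderiv_apply {m n : ℕ∞ω} [IsManifold I 1 M] {f : M → ℝ}
    {X : Π x : M, TangentSpace I x} {p : M} (hf : CMDiffAt n f p) (hX : CMDiffAt m (T% X) p)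
    (hmn : m + 1 ≤ n) : CMDiffAt m (fun q => d% f q (X q)) p := by
  have h := ContMDiffAt.clm_apply_of_inCoordinates (b₁ := id) (b₂ := f) (v := X)
    (ϕ := fun q => mfderiv% f q) (hf.mfderiv_const hmn) hX (hf.of_le (le_self_add.trans hmn))
  rw [contMDiffAt_totalSpace] at h
  simp only [id_eq, trivializationAt_model_space_apply] at h
  exact h.2

variable [IsManifold I ∞ M]

theorem mdifferentiableAt_mvfderiv_apply {f : M → ℝ} {X : Π x : M, TangentSpace I x} {p : M}
    (hf : CMDiffAt 2 f p) (hX : CMDiffAt 1 (T% X) p) : MDiffAt (fun q => d% f q (X q)) p :=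
  (contMDiffAt_mvfderiv_apply hf hX one_add_one_eq_two.le).mdifferentiableAt one_ne_zero

variable [CompleteSpace E]

theorem eventuallyEq_mlieBracket_smul_right {V W : Π x : M, TangentSpace I x} {f : M → ℝ} {p : M}
    (hf : CMDiffAt 1 f p) (hW : CMDiffAt 1 (T% W) p) :
    mlieBracket I V (f • W) =ᶠ[𝓝 p]
      ((fun q => d% f q (V q)) • W + f • mlieBracket I V W : Π x : M, TangentSpace I x) := by
  filter_upwards [eventually_mdifferentiableAt hf, eventually_mdifferentiableAt hW] with q hfq hWq
  exact mlieBracket_smul_right hfq hWq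

theorem mdifferentiableAt_mlieBracket {U V : Π x : M, TangentSpace I x} {p : M}
    (hU : CMDiffAt 2 (T% U) p) (hV : CMDiffAt 2 (T% V) p) :
    MDiffAt (T% (mlieBracket I U V)) p := by
  have : IsManifold I (((2 : ℕ∞) : ℕ∞ω) + 1) M := .of_le (n := ∞) (mod_cast le_top)
  have : IsManifold I (minSmoothness ℝ 2) M := by
    rw [minSmoothness_of_isRCLikeNormedField]; infer_instance
  have hle : minSmoothness ℝ (1 + 1) ≤ 2 :=
    minSmoothness_of_isRCLikeNormedField.trans_le one_add_one_eq_two.le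
  exact (ContMDiffAt.mlieBracket_vectorField (n := 2) hU hV hle).mdifferentiableAt one_ne_zero

theorem mlieBracket_mlieBracket_smul {U V W : Π x : M, TangentSpace I x} {f : M → ℝ} {p : M}
    (hV : CMDiffAt 2 (T% V) p) (hW : CMDiffAt 2 (T% W) p) (hf : CMDiffAt 2 f p) :
    mlieBracket I U (mlieBracket I V (f • W)) p =
      d% (fun q => d% f q (V q)) p (U p) • W p + d% f p (V p) • mlieBracket I U W p
        + (d% f p (U p) • mlieBracket I V W p + f p • mlieBracket I U (mlieBracket I V W) p) := by
  have hW1 : MDiffAt (T% W) p := hW.mdifferentiableAt two_ne_zero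
  have hf1 : MDiffAt f p := hf.mdifferentiableAt two_ne_zero
  have hVf := mdifferentiableAt_mvfderiv_apply hf (hV.of_le one_le_two)
  have hVW := mdifferentiableAt_mlieBracket hV hW
  rw [Filter.EventuallyEq.mlieBracket_vectorField_eq (Filter.EventuallyEq.refl _ U)
    (eventuallyEq_mlieBracket_smul_right (hf.of_le one_le_two) (hW.of_le one_le_two)),
    mlieBracket_add_right (hVf.smul_section hW1) (hf1.smul_section hVW),
    mlieBracket_smul_right hVf hW1, mlieBracket_smul_right hf1 hVW]

theorem mvfderiv_mlieBracket {U V : Π x : M, TangentSpace I x} {f : M → ℝ} {p : M}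
    (hU : CMDiffAt 2 (T% U) p) (hV : CMDiffAt 2 (T% V) p) (hf : CMDiffAt 2 f p) :
    d% f p (mlieBracket I U V p) =
      d% (fun q => d% f q (V q)) p (U p) - d% (fun q => d% f q (U q)) p (V p) := by
  rcases subsingleton_or_nontrivial (TangentSpace I p) with hs | hs
  · simp [Subsingleton.elim (U p) 0, Subsingleton.elim (V p) 0,
      Subsingleton.elim (mlieBracket I U V p) 0]
  obtain ⟨w, hw⟩ := exists_ne (0 : TangentSpace I p)
  have : IsManifold I (minSmoothness ℝ 3) M := by
    rw [minSmoothness_of_isRCLikeNormedField]; infer_instance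
  have hle : minSmoothness ℝ 2 ≤ 2 := minSmoothness_of_isRCLikeNormedField.le
  let W : Π x : M, TangentSpace I x := extend E w
  have hW : CMDiffAt 2 (T% W) p := contMDiffAt_extend I E w
  have hWp : W p = w := extend_apply_self E w
  -- Compare the coefficients of `W` in the Jacobi identities for `U, V, f W` and for `U, V, W`.
  have jacobi_smul := leibniz_identity_mlieBracket_apply (W := f • W) (hU.of_le hle)
    (hV.of_le hle) ((hf.smul_section hW).of_le hle)
  have jacobi := leibniz_identity_mlieBracket_apply (hU.of_le hle) (hV.of_le hle) (hW.of_le hle)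
  rw [mlieBracket_mlieBracket_smul hV hW hf, mlieBracket_mlieBracket_smul hU hW hf,
    mlieBracket_smul_right (hf.mdifferentiableAt two_ne_zero) (hW.mdifferentiableAt two_ne_zero),
    jacobi, hWp] at jacobi_smul
  refine smul_left_injective ℝ hw ?_
  simp only [sub_smul]
  linear_combination (norm := module) -jacobi_smul

end Brackets

section Riemannian

variable {E : Type*} [NormedAddCommGroup E] [NormedSpace ℝ E]
  {H : Type*} [TopologicalSpace H] {I : ModelWithCorners ℝ E H}
  {M : Type*} [TopologicalSpace M] [ChartedSpace H M] [IsManifold I ∞ M]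
  [RiemannianBundle (fun x : M => TangentSpace I x)]
  {U V W X Y Z : Π x : M, TangentSpace I x} {ψ : M → ℝ} {p : M}

theorem contMDiffAt_inner {n : ℕ∞ω} [IsContMDiffRiemannianBundle I n E
    (fun x : M => TangentSpace I x)] (hX : CMDiffAt n (T% X) p) (hY : CMDiffAt n (T% Y) p) :
    CMDiffAt n (fun q => inner ℝ (X q) (Y q)) p :=
  ContMDiffAt.inner_bundle (E := fun x : M => TangentSpace I x) hX hY

variable [FiniteDimensional ℝ E]
  [IsContMDiffRiemannianBundle I ∞ E (fun x : M => TangentSpace I x)]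

theorem mdifferentiableAt_koszul (hX : CMDiffAt 2 (T% X) p) (hY : CMDiffAt 2 (T% Y) p)
    (hZ : CMDiffAt 2 (T% Z) p) : MDiffAt (koszul X Y Z) p := by
  have hderiv {A B C : Π x : M, TangentSpace I x} (hA : CMDiffAt 2 (T% A) p)
      (hB : CMDiffAt 2 (T% B) p) (hC : CMDiffAt 2 (T% C) p) :
      MDiffAt (fun q => d% (fun r => inner ℝ (A r) (B r)) q (C q)) p :=
    mdifferentiableAt_mvfderiv_apply (contMDiffAt_inner hA hB) (hC.of_le one_le_two)
  have hbracket {A B C : Π x : M, TangentSpace I x} (hA : CMDiffAt 2 (T% A) p)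
      (hB : CMDiffAt 2 (T% B) p) (hC : CMDiffAt 2 (T% C) p) :
      MDiffAt (fun q => inner ℝ (mlieBracket I A B q) (C q)) p :=
    mdifferentiableAt_inner (mdifferentiableAt_mlieBracket hA hB)
      (hC.mdifferentiableAt two_ne_zero)
  exact (((((hderiv hX hZ hY).add (hderiv hY hZ hX)).sub (hderiv hY hX hZ)).add
    (hbracket hY hX hZ)).sub (hbracket hY hZ hX)).sub (hbracket hX hZ hY)

theorem mdifferentiableAt_leviCivita (hV : CMDiffAt 2 (T% V) p) (hW : CMDiffAt 2 (T% W) p) :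
    MDiffAt (T% (fun q => leviCivita W q (V q))) p := by
  refine mdifferentiableAt_of_inner (V := fun x : M => TangentSpace I x) one_le_two fun Z hZ => ?_
  refine ((mdifferentiableAt_const (c := (1 / 2 : ℝ))).mul
    (mdifferentiableAt_koszul hW hV hZ)).congr_of_eventuallyEq ?_
  filter_upwards [eventually_mdifferentiableAt (hV.of_le one_le_two),
    eventually_mdifferentiableAt (hW.of_le one_le_two),
    eventually_mdifferentiableAt (hZ.of_le one_le_two)] with q hVq hWq hZq
  have hk : 2 * inner ℝ (leviCivita W q (V q)) (Z q) = koszul W V Z q :=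
    two_inner_nabla hWq hVq hZq
  rw [Pi.mul_apply, ← hk, real_inner_comm]
  ring

/-! ### Curvature and Ricci tensor -/

theorem mvfderiv_mvfderiv_inner (hU : MDiffAt (T% U) p) (hV : CMDiffAt 2 (T% V) p)
    (hW : CMDiffAt 2 (T% W) p) (hZ : CMDiffAt 2 (T% Z) p) :
    d% (fun q => d% (fun r => inner ℝ (W r) (Z r)) q (V q)) p (U p) =
      inner ℝ (leviCivita (fun q => leviCivita W q (V q)) p (U p)) (Z p)
        + inner ℝ (leviCivita W p (V p)) (leviCivita Z p (U p))
        + (inner ℝ (leviCivita W p (U p)) (leviCivita Z p (V p))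
        + inner ℝ (W p) (leviCivita (fun q => leviCivita Z q (V q)) p (U p))) := by
  have hmetric : (fun q => d% (fun r => inner ℝ (W r) (Z r)) q (V q)) =ᶠ[𝓝 p]
      (fun q => inner ℝ (leviCivita W q (V q)) (Z q))
        + fun q => inner ℝ (W q) (leviCivita Z q (V q)) := by
    filter_upwards [eventually_mdifferentiableAt (hV.of_le one_le_two),
      eventually_mdifferentiableAt (hW.of_le one_le_two),
      eventually_mdifferentiableAt (hZ.of_le one_le_two)] with q hVq hWq hZq
    exact leviCivita_metric hVq hWq hZq
  have hW1 := hW.mdifferentiableAt two_ne_zero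
  have hZ1 := hZ.mdifferentiableAt two_ne_zero
  have hVW := mdifferentiableAt_leviCivita hV hW
  have hVZ := mdifferentiableAt_leviCivita hV hZ
  rw [mvfderiv_congr hmetric, mvfderiv_add (mdifferentiableAt_inner hVW hZ1)
    (mdifferentiableAt_inner hW1 hVZ), _root_.add_apply,
    leviCivita_metric hU hVW hZ1, leviCivita_metric hU hW1 hVZ]

theorem inner_curvatureField_right (hU : CMDiffAt 2 (T% U) p) (hV : CMDiffAt 2 (T% V) p)
    (hW : CMDiffAt 2 (T% W) p) (hZ : CMDiffAt 2 (T% Z) p) :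
    inner ℝ (W p) (curvatureField U V Z p) = - inner ℝ (curvatureField U V W p) (Z p) := by
  have hcomm := mvfderiv_mlieBracket hU hV (contMDiffAt_inner hW hZ)
  rw [mvfderiv_mvfderiv_inner (hU.mdifferentiableAt two_ne_zero) hV hW hZ,
    mvfderiv_mvfderiv_inner (hV.mdifferentiableAt two_ne_zero) hU hW hZ,
    leviCivita_metric (mdifferentiableAt_mlieBracket hU hV) (hW.mdifferentiableAt two_ne_zero)
      (hZ.mdifferentiableAt two_ne_zero)] at hcomm
  simp only [curvatureField, inner_sub_left, inner_sub_right]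
  linarith

theorem inner_curvature_right (u v w z : TangentSpace I p) :
    inner ℝ w (curvature p u v z) = - inner ℝ (curvature p u v w) z := by
  have h := inner_curvatureField_right (contMDiffAt_extend I E u) (contMDiffAt_extend I E v)
    (contMDiffAt_extend I E w) (contMDiffAt_extend I E z)
  rwa [extend_apply_self, extend_apply_self] at h

theorem curvature_eq_curvatureField (hW : CMDiffAt 2 (T% W) p) (u v : TangentSpace I p) :
    curvature p u v (W p) = curvatureField (extend E u) (extend E v) W p := by
  refine ext_inner_left ℝ fun z => ?_
  have h := inner_curvatureField_right (contMDiffAt_extend I E u) (contMDiffAt_extend I E v)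
    (contMDiffAt_extend I E z) hW
  rw [extend_apply_self] at h
  rw [inner_curvature_right, h, curvature]

theorem curvature_smul (c : ℝ) (u v w : TangentSpace I p) :
    curvature p u v (c • w) = c • curvature p u v w := by
  refine ext_inner_left ℝ fun z => ?_
  rw [inner_curvature_right, real_inner_smul_right, real_inner_smul_right, inner_curvature_right,
    mul_neg]

theorem ricci_smul_right (c : ℝ) (v w : TangentSpace I p) :
    ricci p v (c • w) = c * ricci p v w := by
  simp only [ricci, curvature_smul, real_inner_smul_left, Finset.mul_sum]

/-! ### Closed conformal vector fields -/

/-- `X` is a closed conformal vector field with factor `ψ`, i.e. `∇_v X = ψ v` for all `v`. It is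
assumed to be `C³` so that the Hessian of `ψ` exists wherever `X` does not vanish. -/
structure IsClosedConformal (X : Π x : M, TangentSpace I x) (ψ : M → ℝ) : Prop where
  contMDiff : CMDiff 3 (T% X)
  leviCivita_apply : ∀ (q : M) (v : TangentSpace I q), leviCivita X q v = ψ q • v

/-- The coefficient `φ = dψ(X) / |X|²` of `X` in the gradient of the conformal factor `ψ`; it has
the junk value `0` at the zeros of `X`. -/
noncomputable def gradCoeff (X : Π x : M, TangentSpace I x) (ψ : M → ℝ) (q : M) : ℝ :=
  d% ψ q (X q) / inner ℝ (X q) (X q)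

namespace IsClosedConformal

theorem contMDiffAt_two (h : IsClosedConformal X ψ) : CMDiffAt 2 (T% X) p :=
  (h.contMDiff p).of_le (mod_cast Nat.le_succ 2)

theorem mdifferentiableAt (h : IsClosedConformal X ψ) : MDiffAt (T% X) p :=
  h.contMDiffAt_two.mdifferentiableAt two_ne_zero

theorem eventually_ne_zero (h : IsClosedConformal X ψ) (hp : X p ≠ 0) : ∀ᶠ q in 𝓝 p, X q ≠ 0 := by
  have hcont : ContinuousAt (fun q => inner ℝ (X q) (X q)) p :=
    (mdifferentiableAt_inner h.mdifferentiableAt h.mdifferentiableAt).continuousAt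
  exact (hcont.eventually_ne (inner_self_ne_zero.2 hp)).mono fun q hq => inner_self_ne_zero.1 hq

theorem mvfderiv_inner_self (h : IsClosedConformal X ψ) (v : TangentSpace I p) :
    d% (fun q => inner ℝ (X q) (X q)) p v = 2 * ψ p * inner ℝ (X p) v := by
  obtain ⟨V, hV, rfl⟩ := exists_extension v
  rw [leviCivita_metric hV h.mdifferentiableAt h.mdifferentiableAt, h.leviCivita_apply,
    real_inner_smul_left, real_inner_smul_right, real_inner_comm]
  ring

theorem contMDiffAt_factor (h : IsClosedConformal X ψ) (hp : X p ≠ 0) : CMDiffAt 2 ψ p := by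
  have hnum : CMDiffAt 2 (fun q => d% (fun r => inner ℝ (X r) (X r)) q (X q)) p :=
    contMDiffAt_mvfderiv_apply (contMDiffAt_inner (h.contMDiff p) (h.contMDiff p))
      h.contMDiffAt_two two_add_one_eq_three.le
  have hden : CMDiffAt 2 (fun q => 2 * inner ℝ (X q) (X q)) p :=
    contMDiffAt_const.mul (contMDiffAt_inner h.contMDiffAt_two h.contMDiffAt_two)
  have hne {q} (hq : X q ≠ 0) : 2 * inner ℝ (X q) (X q) ≠ 0 :=
    mul_ne_zero two_ne_zero (inner_self_ne_zero.2 hq)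
  refine (hnum.div₀ hden (hne hp)).congr_of_eventuallyEq ?_
  filter_upwards [h.eventually_ne_zero hp] with q hq
  rw [Pi.div_apply, h.mvfderiv_inner_self, eq_div_iff (hne hq)]
  ring

theorem curvatureField_eq (h : IsClosedConformal X ψ) (hψ : MDiffAt ψ p) (hU : MDiffAt (T% U) p)
    (hV : MDiffAt (T% V) p) :
    curvatureField U V X p = d% ψ p (U p) • V p - d% ψ p (V p) • U p := by
  have hnabla (W : Π x : M, TangentSpace I x) : (fun q => leviCivita X q (W q)) = ψ • W :=
    funext fun q => h.leviCivita_apply q (W q)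
  have hsmul {W : Π x : M, TangentSpace I x} (hW : MDiffAt (T% W) p) :
      leviCivita (ψ • W) p = ψ p • leviCivita W p + (d% ψ p).smulRight (W p) :=
    nabla_smul hW hψ
  rw [curvatureField, hnabla, hnabla, hsmul hU, hsmul hV, h.leviCivita_apply,
    ← leviCivita_torsion hU hV]
  simp only [add_apply, smul_apply, ContinuousLinearMap.smulRight_apply]
  module

theorem curvature_apply (h : IsClosedConformal X ψ) (hψ : MDiffAt ψ p) (u v : TangentSpace I p) :
    curvature p u v (X p) = d% ψ p u • v - d% ψ p v • u := by
  rw [curvature_eq_curvatureField h.contMDiffAt_two, h.curvatureField_eq hψ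
    (mdifferentiableAt_extend I E u) (mdifferentiableAt_extend I E v), extend_apply_self,
    extend_apply_self]

theorem mvfderiv_factor (h : IsClosedConformal X ψ) (hp : X p ≠ 0) (v : TangentSpace I p) :
    d% ψ p v = gradCoeff X ψ p * inner ℝ (X p) v := by
  have hψ := (h.contMDiffAt_factor hp).mdifferentiableAt two_ne_zero
  have hskew : inner ℝ (X p) (curvature p v (X p) (X p)) = 0 := by
    have := inner_curvature_right v (X p) (X p) (X p)
    rw [real_inner_comm] at this ⊢
    linarith
  rw [h.curvature_apply hψ, inner_sub_right, real_inner_smul_right, real_inner_smul_right,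
    sub_eq_zero] at hskew
  rw [gradCoeff, div_mul_eq_mul_div, eq_div_iff (inner_self_ne_zero.2 hp), hskew]

theorem mdifferentiableAt_gradCoeff (h : IsClosedConformal X ψ) (hp : X p ≠ 0) :
    MDiffAt (gradCoeff X ψ) p := by
  have hX1 : CMDiffAt 1 (T% X) p := h.contMDiffAt_two.of_le one_le_two
  have hnum : CMDiffAt 1 (fun q => d% ψ q (X q)) p :=
    contMDiffAt_mvfderiv_apply (h.contMDiffAt_factor hp) hX1 one_add_one_eq_two.le
  exact (hnum.div₀ (contMDiffAt_inner hX1 hX1) (inner_self_ne_zero.2 hp)).mdifferentiableAt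
    one_ne_zero

theorem grad_factor (h : IsClosedConformal X ψ) (hp : X p ≠ 0) :
    grad I ψ p = gradCoeff X ψ p • X p := by
  refine ext_inner_right ℝ fun w => ?_
  rw [grad, inner_sharp, h.mvfderiv_factor hp, real_inner_smul_left]

theorem leviCivita_grad_factor (h : IsClosedConformal X ψ) (hp : X p ≠ 0) (v : TangentSpace I p) :
    leviCivita (grad I ψ) p v =
      (gradCoeff X ψ p * ψ p) • v + d% (gradCoeff X ψ) p v • X p := by
  have hφ := h.mdifferentiableAt_gradCoeff hp
  have hφX : MDiffAt (T% (gradCoeff X ψ • X)) p := hφ.smul_section h.mdifferentiableAt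
  have hgrad : ∀ᶠ q in 𝓝 p, grad I ψ q = (gradCoeff X ψ • X) q :=
    (h.eventually_ne_zero hp).mono fun q hq => h.grad_factor hq
  have hgrad_diff : MDiffAt (T% (grad I ψ)) p :=
    hφX.congr_of_eventuallyEq (hgrad.mono fun q hq => congrArg (TotalSpace.mk' E q) hq)
  have hcongr : leviCivita (grad I ψ) p = leviCivita (gradCoeff X ψ • X) p :=
    leviCivita.isCovariantDerivativeOnUniv.congr_of_eventuallyEq hgrad_diff hφX Filter.univ_mem
      hgrad
  have hleibniz : leviCivita (gradCoeff X ψ • X) p =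
      gradCoeff X ψ p • leviCivita X p + (d% (gradCoeff X ψ) p).smulRight (X p) :=
    nabla_smul h.mdifferentiableAt hφ
  rw [hcongr, hleibniz, add_apply, smul_apply, h.leviCivita_apply, smul_smul,
    ContinuousLinearMap.smulRight_apply]

theorem hessian_factor (h : IsClosedConformal X ψ) (hp : X p ≠ 0) (v w : TangentSpace I p) :
    hessian ψ p v w =
      gradCoeff X ψ p * ψ p * inner ℝ v w + d% (gradCoeff X ψ) p v * inner ℝ (X p) w := by
  rw [hessian, h.leviCivita_grad_factor hp, inner_add_left, real_inner_smul_left,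
    real_inner_smul_left]

theorem laplacian_factor (h : IsClosedConformal X ψ) (hp : X p ≠ 0) :
    laplacian I ψ p =
      Module.finrank ℝ E * (gradCoeff X ψ p * ψ p) + d% (gradCoeff X ψ) p (X p) := by
  simp only [laplacian, h.hessian_factor hp, Finset.sum_add_distrib, ← Finset.mul_sum,
    sum_inner_self, sum_apply_mul_inner]
  rw [mul_comm, show Module.finrank ℝ (TangentSpace I p) = Module.finrank ℝ E from rfl]

theorem ricci_apply (h : IsClosedConformal X ψ) (hp : X p ≠ 0) (v : TangentSpace I p) :
    ricci p v (X p) = (1 - Module.finrank ℝ E) * d% ψ p v := by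
  have hψ := (h.contMDiffAt_factor hp).mdifferentiableAt two_ne_zero
  simp only [ricci, h.curvature_apply hψ, inner_sub_left, real_inner_smul_left,
    Finset.sum_sub_distrib, ← Finset.mul_sum, sum_inner_self, sum_apply_mul_inner]
  rw [show Module.finrank ℝ (TangentSpace I p) = Module.finrank ℝ E from rfl]
  ring

end IsClosedConformal

end Riemannian

end Riem

theorem theorem1p4_general {E : Type*} [NormedAddCommGroup E] [NormedSpace ℝ E]
    [FiniteDimensional ℝ E] {H : Type*} [TopologicalSpace H] {I : ModelWithCorners ℝ E H}
    {M : Type*} [TopologicalSpace M] [ChartedSpace H M] [IsManifold I ∞ M]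
    [RiemannianBundle (fun x : M => TangentSpace I x)]
    [IsContMDiffRiemannianBundle I ∞ E (fun x : M => TangentSpace I x)]
    {X : Π x : M, TangentSpace I x} {ψ : M → ℝ} (hX : Riem.IsClosedConformal X ψ)
    {p : M} {e : TangentSpace I p} (hp : X p ≠ 0) (he : e = ‖X p‖⁻¹ • X p) :
    Riem.hessian ψ p e e - ψ p * Riem.ricci p e e = Riem.laplacian I ψ p := by
  have hunit : inner ℝ e e = 1 :=
    inner_self_eq_one_of_norm_eq_one (he ▸ NormedSpace.norm_normalize hp)
  have hXe : ‖X p‖⁻¹ * inner ℝ (X p) e = 1 := by rw [← real_inner_smul_left, ← he, hunit]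
  have hhess : Riem.hessian ψ p e e =
      Riem.gradCoeff X ψ p * ψ p + d% (Riem.gradCoeff X ψ) p (X p) := by
    have hφ : d% (Riem.gradCoeff X ψ) p e = ‖X p‖⁻¹ * d% (Riem.gradCoeff X ψ) p (X p) := by
      rw [he, map_smul, smul_eq_mul]
    rw [hX.hessian_factor hp, hunit, hφ]
    linear_combination d% (Riem.gradCoeff X ψ) p (X p) * hXe
  have hric : Riem.ricci p e e = (1 - Module.finrank ℝ E) * Riem.gradCoeff X ψ p := by
    conv_lhs => rw [he, Riem.ricci_smul_right, ← he, hX.ricci_apply hp, hX.mvfderiv_factor hp]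
    linear_combination (1 - Module.finrank ℝ E) * Riem.gradCoeff X ψ p * hXe
  rw [hhess, hric, hX.laplacian_factor hp]
  ring

theorem theorem1p4 {n : ℕ} (hn : 2 ≤ n)
    {M : Type*} [TopologicalSpace M] [ChartedSpace (EuclideanSpace ℝ (Fin n)) M]
    [IsManifold (𝓡 n) ∞ M]
    [RiemannianBundle (fun x : M => TangentSpace (𝓡 n) x)]
    [IsContMDiffRiemannianBundle (𝓡 n) ∞ (EuclideanSpace ℝ (Fin n))
      (fun x : M => TangentSpace (𝓡 n) x)]
    (X : Π x : M, TangentSpace (𝓡 n) x) (ρ R ψ : M → ℝ)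
    (hR : R = Riem.scalarCurvature (𝓡 n)) (hψ : ψ = Riem.conformalFactor (𝓡 n) ρ)
    (hsol : Riem.IsAlmostYamabeSoliton X ρ) (hclosed : Riem.IsClosedField X ρ) :
    Riem.IsKilling X ∨
      ∀ (p : M) (e : TangentSpace (𝓡 n) p), X p ≠ 0 → e = ‖X p‖⁻¹ • X p →
        Riem.hessian ψ p e e + R p * ψ p / (n - 1) * inner ℝ e e - ψ p * Riem.ricci p e e
          = Riem.laplacian (𝓡 n) ψ p + R p * ψ p / (n - 1) := by
  refine .inr fun p e hp he => ?_
  have hX : Riem.IsClosedConformal X ψ :=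
    ⟨hsol.smooth_field.of_le ENat.LEInfty.out, by rw [hψ]; exact hclosed⟩
  have hunit : inner ℝ e e = 1 :=
    inner_self_eq_one_of_norm_eq_one (he ▸ NormedSpace.norm_normalize hp)
  linear_combination theorem1p4_general hX hp he + R p * ψ p / (n - 1) * hunit
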